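/- Let $G_{\mathbb Q}=\mathrm{Gal}(\overline{\mathbb Q}/\mathbb Q)$. For an elliptic curve $E/\mathbb Q$ and an integer $N\ge 1$ let $E[N]$ be the group of points of $E(\overline{\mathbb Q})$ killed by $N$, a $\mathbb Z/N\mathbb Z$-module on which $G_{\mathbb Q}$ acts, and let $\overline\rho_{E,N}\colon G_{\mathbb Q}\to \mathrm{Aut}(E[N])$ be the resulting mod-$N$ Galois representation. With respect to a basis $\{P,Q\}$ of $E[N]$ we write $\overline\rho_{E,N}(\sigma)=\begin{bmatrix}A&C\\B&D\end{bmatrix}$, with integers $A,B,C,D$ determined modulo $N$, when $\sigma(P)=[A]P+[B]Q$ and $\sigma(Q)=[C]P+[D]Q$. A $\mathbb Q$-isogeny is a non-constant homomorphism $\phi\colon E\to E'$ of algebraic groups defined over $\mathbb Q$. A finite subgroup $H$ of $E(\overline{\mathbb Q})$ is $\mathbb Q$-rational if $\sigma(H)=H$ for all $\sigma\in G_{\mathbb Q}$. **Lemma.** Let $E/\mathbb Q$ and $E'/\mathbb Q$ be elliptic curves and let $\phi\colon E\to E'$ be a $\mathbb Q$-isogeny whose kernel is finite, cyclic and $\mathbb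 Q$-rational. Let $\ell$ be a prime, let $r\ge 0$ be the integer such that $\ell^r$ is the greatest power of $\ell$ dividing the order of $\ker\phi$, and let $m\ge 0$ be an integer. Then there is a basis $\{P,Q\}$ of $E[\ell^{m+r}]$ such that 1. for every $\sigma\in G_{\mathbb Q}$ and all integers $A,B,C,D$ with $\overline\rho_{E,\ell^{m+r}}(\sigma)=\begin{bmatrix}A&C\\B&D\end{bmatrix}$ in the basis $\{P,Q\}$, one has $\ell^r\mid C$; 2. $\{\phi([\ell^r]P),\,\phi(Q)\}$ is a basis of $E'[\ell^m]$; 3. for $\sigma$ and $A,B,C,D$ as in (1), in the basis $\{\phi([\ell^r]P),\phi(Q)\}$ one has $\overline\rho_{E',\ell^m}(\sigma)=\begin{bmatrix}A&C/\ell^r\\ \ell^r B&D\end{bmatrix}$ (entries modulo $\ell^m$). -/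

import Mathlib

open scoped WeierstrassCurve.Affine

namespace EllQ

/-- The fixed algebraic closure of the rational numbers. -/
abbrev Qbar : Type := AlgebraicClosure ℚ

noncomputable instance instDecidableEqQbar : DecidableEq Qbar := Classical.decEq _

/-- The group of points `E(ℚ̄)` of a Weierstrass curve `E` over `ℚ`. -/
abbrev Pts (E : WeierstrassCurve ℚ) : Type := (E.toAffine⁄Qbar).Point

/-- The action of a Galois automorphism on `E(ℚ̄)`, through the coordinates of points. -/
noncomputable def galAct (E : WeierstrassCurve ℚ) (σ : Field.absoluteGaloisGroup ℚ) :
    Pts E →+ Pts E :=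
  WeierstrassCurve.Affine.Point.map (W' := E.toAffine)
    (AlgEquiv.toAlgHom (R := ℚ) (A₁ := Qbar) (A₂ := Qbar) σ)

/-- The `N`-torsion subgroup `E[N]` of `E(ℚ̄)`. -/
noncomputable abbrev Tors (E : WeierstrassCurve ℚ) (N : ℕ) : AddSubgroup (Pts E) :=
  AddSubgroup.torsionBy (Pts E) (N : ℤ)

noncomputable instance instModuleTors (E : WeierstrassCurve ℚ) (N : ℕ) :
    Module (ZMod N) (Tors E N) :=
  AddSubgroup.torsionBy.zmodModule

theorem galAct_mem_tors (E : WeierstrassCurve ℚ) (N : ℕ) (σ : Field.absoluteGaloisGroup ℚ)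
    (P : Tors E N) : galAct E σ P ∈ Tors E N := by
  rw [AddSubgroup.torsionBy.nsmul_iff, ← map_nsmul,
    AddSubgroup.torsionBy.nsmul_iff.mp P.2, map_zero]

/-- The action of a Galois automorphism on `E[N]`, a `ℤ/N`-linear map. -/
noncomputable def galTors (E : WeierstrassCurve ℚ) (N : ℕ) (σ : Field.absoluteGaloisGroup ℚ) :
    Tors E N →ₗ[ZMod N] Tors E N :=
  AddMonoidHom.toZModLinearMap N
    (((galAct E σ).comp (Tors E N).subtype).codRestrict (Tors E N) (galAct_mem_tors E N σ))

/-- The mod-`N` Galois representation `ρ̄_{E,N}` attached to `E`: the action of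
`Gal(ℚ̄/ℚ)` on the `ℤ/N`-module `E[N]`. -/
noncomputable def galRep (E : WeierstrassCurve ℚ) (N : ℕ) :
    Representation (ZMod N) (Field.absoluteGaloisGroup ℚ) (Tors E N) where
  toFun := galTors E N
  map_one' := by
    ext P
    rcases P with ⟨_ | ⟨x, y, h⟩, hP⟩ <;> rfl
  map_mul' σ τ := by
    ext P
    rcases P with ⟨_ | ⟨x, y, h⟩, hP⟩ <;> rfl

/-- Homogeneous coordinates of a point in the projective plane: `O = [0 : 1 : 0]` and
`(x, y) = [x : y : 1]`. -/
noncomputable def coords {E : WeierstrassCurve ℚ} : Pts E → Fin 3 → Qbar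
  | .zero => ![0, 1, 0]
  | .some x y _ => ![x, y, 1]

/-- A map `f : E(ℚ̄) → E'(ℚ̄)` is a morphism of projective curves defined over `ℚ`: around every
point `P` there are homogeneous polynomials `F₀, F₁, F₂` of the same degree with rational
coefficients, not all vanishing at `P`, such that `f(R) = [F₀(R) : F₁(R) : F₂(R)]` at all points
`R` of `E` at which they do not all vanish (the factor `c` is `0` if they do all vanish at `R`). -/
def IsMorphism {E E' : WeierstrassCurve ℚ} (f : Pts E → Pts E') : Prop :=
  ∀ P : Pts E, ∃ (d : ℕ) (F : Fin 3 → MvPolynomial (Fin 3) ℚ),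
    (∀ i, (F i).IsHomogeneous d) ∧
    (∃ i, MvPolynomial.aeval (coords P) (F i) ≠ 0) ∧
    ∀ R : Pts E, ∃ c : Qbar, ∀ i, MvPolynomial.aeval (coords R) (F i) = c * coords (f R) i

/-- A `ℚ`-isogeny `E → E'`: a non-constant homomorphism of algebraic groups defined over `ℚ`, i.e.
a non-zero homomorphism `E(ℚ̄) → E'(ℚ̄)` that is a morphism of curves defined over `ℚ`. -/
structure Isogeny (E E' : WeierstrassCurve ℚ) where
  /-- The underlying homomorphism on points. -/
  hom : Pts E →+ Pts E'
  isMorphism : IsMorphism hom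
  ne_zero : hom ≠ 0

/-- A subgroup `H` of `E(ℚ̄)` is `ℚ`-rational if `σ(H) = H` for every `σ` in `Gal(ℚ̄/ℚ)`. -/
def IsRational {E : WeierstrassCurve ℚ} (H : AddSubgroup (Pts E)) : Prop :=
  ∀ σ : Field.absoluteGaloisGroup ℚ, H.map (galAct E σ) = H

end EllQ

/-! Let `g` generate the `ℓ`-primary part of `ker φ`, a cyclic group of order `ℓ ^ r`. Choose `Q` of
order `ℓ ^ (m + r)` with `ℓ ^ m • Q = g` and complete it to a basis `P, Q` of the `ℓ ^ (m +
r)`-torsion; there `ker φ` is exactly the set of multiples of `ℓ ^ m • Q`. Since `σ` preserves `ker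
φ`, the `P`-coordinate `ℓ ^ m * C` of `σ (ℓ ^ m • Q)` vanishes modulo `ℓ ^ (m + r)`, whence `ℓ ^ r ∣
C`. The same description of the kernel makes `φ (ℓ ^ r • P)` and `φ Q` independent modulo `ℓ ^ m`,
and the new matrix results from applying `φ`, which commutes with Galois (`IsMorphism.map_galAct`).

The existence of `Q` and `P` is pure group theory once `n`-torsion is known to have `n ^ 2` elements
(`card_nsmul_eq_zero`). For this, `x (n • P)` is written as a reduced fraction `U / V` in `x P` with
`U` monic of degree `n ^ 2` (`exists_isMulByX`); a generic fibre of multiplication by `n` then has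
`n ^ 2` points, and every nonempty fibre is a translate of the kernel. -/

namespace WeierstrassCurve

/-! ### The `x`-coordinates of `P + Q` and `P - Q`. -/

/-- The values of `addSubMap` on the symmetric square of two coordinate vectors on the line. -/
lemma eval_addSubMap {R : Type*} [CommRing R] (W : WeierstrassCurve R) (v : Fin 3 → R) :
    (fun i ↦ (addSubMap W i).eval v) =
      ![v 0 ^ 2 - W.b₄ * v 0 * v 2 - W.b₆ * v 1 * v 2 - W.b₈ * v 2 ^ 2,
        2 * v 1 * v 0 + W.b₂ * v 0 * v 2 + W.b₄ * v 1 * v 2 + W.b₆ * v 2 ^ 2,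
        v 1 ^ 2 - 4 * v 0 * v 2] := by
  ext i
  fin_cases i <;> simp [addSubMap]

section

variable {F : Type*} [Field F] {a₁ a₂ a₃ a₄ a₆ x₁ y₁ x₂ y₂ : F}

/-- The second slope is that of the line through `P` and `-Q`. In the sum the `y`-coordinates
survive only through the left sides of the two curve equations. -/
lemma x_add_add_x_sub (hx : x₁ ≠ x₂)
    (e₁ : y₁ ^ 2 + a₁ * x₁ * y₁ + a₃ * y₁ = x₁ ^ 3 + a₂ * x₁ ^ 2 + a₄ * x₁ + a₆)
    (e₂ : y₂ ^ 2 + a₁ * x₂ * y₂ + a₃ * y₂ = x₂ ^ 3 + a₂ * x₂ ^ 2 + a₄ * x₂ + a₆) :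
    (x₁ - x₂) ^ 2 *
      (((y₁ - y₂) / (x₁ - x₂)) ^ 2 + a₁ * ((y₁ - y₂) / (x₁ - x₂)) - a₂ - x₁ - x₂ +
        (((y₁ - (-y₂ - a₁ * x₂ - a₃)) / (x₁ - x₂)) ^ 2 +
          a₁ * ((y₁ - (-y₂ - a₁ * x₂ - a₃)) / (x₁ - x₂)) - a₂ - x₁ - x₂)) =
      2 * (x₁ + x₂) * (x₁ * x₂) + (a₁ ^ 2 + 4 * a₂) * (x₁ * x₂) +
        (2 * a₄ + a₁ * a₃) * (x₁ + x₂) + (a₃ ^ 2 + 4 * a₆) := by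
  have hx' := sub_ne_zero.mpr hx
  field_simp
  linear_combination 2 * e₁ + 2 * e₂

lemma x_add_mul_x_sub (hx : x₁ ≠ x₂)
    (e₁ : y₁ ^ 2 + a₁ * x₁ * y₁ + a₃ * y₁ = x₁ ^ 3 + a₂ * x₁ ^ 2 + a₄ * x₁ + a₆)
    (e₂ : y₂ ^ 2 + a₁ * x₂ * y₂ + a₃ * y₂ = x₂ ^ 3 + a₂ * x₂ ^ 2 + a₄ * x₂ + a₆) :
    (x₁ - x₂) ^ 2 *
      ((((y₁ - y₂) / (x₁ - x₂)) ^ 2 + a₁ * ((y₁ - y₂) / (x₁ - x₂)) - a₂ - x₁ - x₂) *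
        (((y₁ - (-y₂ - a₁ * x₂ - a₃)) / (x₁ - x₂)) ^ 2 +
          a₁ * ((y₁ - (-y₂ - a₁ * x₂ - a₃)) / (x₁ - x₂)) - a₂ - x₁ - x₂)) =
      (x₁ * x₂) ^ 2 - (2 * a₄ + a₁ * a₃) * (x₁ * x₂) - (a₃ ^ 2 + 4 * a₆) * (x₁ + x₂) -
        (a₁ ^ 2 * a₆ + 4 * a₂ * a₆ - a₁ * a₃ * a₄ + a₂ * a₃ ^ 2 - a₄ ^ 2) := by
  have hx' := sub_ne_zero.mpr hx
  -- The curve equations are linear in `a₆` and `a₄`; eliminating both leaves an identity of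
  -- rational functions.
  obtain rfl : a₆ = y₁ ^ 2 + a₁ * x₁ * y₁ + a₃ * y₁ - (x₁ ^ 3 + a₂ * x₁ ^ 2 + a₄ * x₁) := by
    linear_combination -e₁
  obtain rfl : a₄ = (y₁ ^ 2 + a₁ * x₁ * y₁ + a₃ * y₁ - (y₂ ^ 2 + a₁ * x₂ * y₂ + a₃ * y₂) -
      (x₁ ^ 3 + a₂ * x₁ ^ 2 - x₂ ^ 3 - a₂ * x₂ ^ 2)) / (x₁ - x₂) := by
    field_simp
    linear_combination e₂
  field_simp
  ring

end

namespace Affine.Point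

variable {F : Type*} [Field F] [DecidableEq F] {W : Affine F}

lemma x_add_of_ne {x₁ y₁ x₂ y₂ : F} (h₁ : W.Nonsingular x₁ y₁) (h₂ : W.Nonsingular x₂ y₂)
    (hx : x₁ ≠ x₂) : ∃ y h, some x₁ y₁ h₁ + some x₂ y₂ h₂ =
      some (((y₁ - y₂) / (x₁ - x₂)) ^ 2 + W.a₁ * ((y₁ - y₂) / (x₁ - x₂)) - W.a₂ - x₁ - x₂) y h := by
  rw [← slope_of_X_ne (W := W) hx, add_of_X_ne hx]
  exact ⟨_, _, rfl⟩

/-- On `x`-coordinates, `(P, Q) ↦ (P + Q, P - Q)` is given by `addSubMap`. -/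
theorem exists_addSubMap_sym2x (P Q : W.Point) :
    ∃ c : F, (fun i ↦ (addSubMap W i).eval (P.sym2x Q)) = c • (P + Q).sym2x (P - Q) := by
  rw [eval_addSubMap]
  rcases P with _ | ⟨x₁, y₁, h₁⟩
  · rcases Q with _ | ⟨x₂, y₂, h₂⟩
    · exact ⟨1, by ext i; fin_cases i <;> simp [← zero_def]⟩
    · refine ⟨1, ?_⟩
      rw [← zero_def, zero_add, zero_sub, sym2x_neg_right]
      ext i; fin_cases i <;> simp <;> ring
  rcases Q with _ | ⟨x₂, y₂, h₂⟩
  · refine ⟨1, ?_⟩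
    rw [← zero_def, add_zero, sub_zero]
    ext i; fin_cases i <;> simp <;> ring
  have e₁ := (equation_iff _ _).mp h₁.1
  have e₂ := (equation_iff _ _).mp h₂.1
  by_cases hx : x₁ = x₂
  -- Equal `x` means `Q = ±P`, so up to order the pair `P + Q, P - Q` is `2P, 0`; what remains is
  -- the duplication formula.
  · have key : ∀ (x y : F) (h : W.Nonsingular x y), ∃ c : F,
        ![x ^ 4 - W.b₄ * x ^ 2 - 2 * W.b₆ * x - W.b₈,
          4 * x ^ 3 + W.b₂ * x ^ 2 + 2 * W.b₄ * x + W.b₆, 0] =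
        c • (some x y h + some x y h).sym2x 0 := by
      intro x y h
      have e := (equation_iff _ _).mp h.1
      by_cases hy : y = W.negY x y
      · refine ⟨x ^ 4 - W.b₄ * x ^ 2 - 2 * W.b₆ * x - W.b₈, ?_⟩
        rw [add_self_of_Y_eq hy, sym2x_zero_zero]
        have hy' : 2 * y + W.a₁ * x + W.a₃ = 0 := by
          rw [negY] at hy; linear_combination hy
        ext i; fin_cases i <;> simp
        simp only [b₂, b₄, b₆]
        linear_combination (2 * y + W.a₁ * x + W.a₃) * hy' - 4 * e
      · refine ⟨4 * x ^ 3 + W.b₂ * x ^ 2 + 2 * W.b₄ * x + W.b₆, ?_⟩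
        rw [add_self_of_Y_ne hy, sym2x_some_zero, slope_of_Y_ne rfl hy]
        have hy' : y - W.negY x y ≠ 0 := sub_ne_zero.mpr hy
        rw [negY] at hy'
        ext i; fin_cases i <;> simp
        rw [eq_comm]
        have : 4 * x ^ 3 + W.b₂ * x ^ 2 + 2 * W.b₄ * x + W.b₆ = (y - (-y - W.a₁ * x - W.a₃)) ^ 2 := by
          simp only [b₂, b₄, b₆]
          linear_combination -4 * e
        rw [this]
        field_simp
        simp only [b₄, b₆, b₈]
        have e' : W.a₆ = y ^ 2 + W.a₁ * x * y + W.a₃ * y - (x ^ 3 + W.a₂ * x ^ 2 + W.a₄ * x) := by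
          linear_combination -e
        rw [e']
        ring
    obtain ⟨c, hc⟩ := key x₁ y₁ h₁
    refine ⟨c, ?_⟩
    have hs : (some x₁ y₁ h₁ + some x₂ y₂ h₂).sym2x (some x₁ y₁ h₁ - some x₂ y₂ h₂) =
        (some x₁ y₁ h₁ + some x₁ y₁ h₁).sym2x 0 := by
      rcases X_eq_iff.mp hx with h | h
      · rw [← h, sub_self]
      · rw [eq_neg_iff_add_eq_zero.mp h, sym2x_comm, ← neg_eq_iff_eq_neg.mpr h, sub_neg_eq_add]
    rw [hs, ← hc, sym2x_some_some, ← hx]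
    ext i; fin_cases i <;> simp <;> ring
  · obtain ⟨y, h, hadd⟩ := x_add_of_ne h₁ h₂ hx
    obtain ⟨y', h', hsub⟩ := x_add_of_ne h₁ ((nonsingular_neg x₂ y₂).mpr h₂) hx
    rw [← neg_some h₂, ← sub_eq_add_neg] at hsub
    rw [hadd, hsub, sym2x_some_some, sym2x_some_some]
    have hx' := sub_ne_zero.mpr hx
    refine ⟨(x₁ - x₂) ^ 2, ?_⟩
    ext i; fin_cases i <;> simp [negY]
    · rw [eq_comm, b₄, b₆, b₈]
      exact x_add_mul_x_sub hx e₁ e₂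
    · rw [eq_comm, b₂, b₄, b₆]
      exact x_add_add_x_sub hx e₁ e₂
    · ring

end Affine.Point

end WeierstrassCurve

/-! ### Multiplication by `n` on `x`-coordinates. -/

namespace WeierstrassCurve.Affine

open Polynomial

variable {K : Type*} [Field K] {W : Affine K}

lemma exists_point_of_x [IsAlgClosed K] [W.IsElliptic] (x : K) : ∃ y, W.Nonsingular x y := by
  let p : K[X] := X ^ 2 + C (W.a₁ * x + W.a₃) * X - C (x ^ 3 + W.a₂ * x ^ 2 + W.a₄ * x + W.a₆)
  have hp : p.degree = 2 := by
    simp only [p]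
    compute_degree!
  obtain ⟨y, hy⟩ := IsAlgClosed.exists_root p (by rw [hp]; decide)
  refine ⟨y, equation_iff_nonsingular.mp ((equation_iff x y).mpr ?_)⟩
  simp only [p, IsRoot.def, eval_sub, eval_add, eval_pow, eval_X, eval_mul, eval_C] at hy
  linear_combination hy

/-- `addSubMap` applied to the coordinate vectors `(U : V)` and `(X : 1)`. -/
noncomputable def addSubX (W : Affine K) (U V : K[X]) : Fin 3 → K[X] :=
  ![(U * X) ^ 2 - (C W.b₄ * (U * X) * V + C W.b₆ * (U + X * V) * V + C W.b₈ * V ^ 2),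
    2 * (U + X * V) * (U * X) + C W.b₂ * (U * X) * V + C W.b₄ * (U + X * V) * V + C W.b₆ * V ^ 2,
    (U + X * V) ^ 2 - 4 * (U * X) * V]

lemma eval_addSubX (W : Affine K) (U V : K[X]) (x : K) :
    (fun i ↦ (addSubX W U V i).eval x) = fun i ↦ (addSubMap W i).eval
      ![U.eval x * x, U.eval x + x * V.eval x, V.eval x] := by
  rw [eval_addSubMap]
  ext i
  fin_cases i <;> simp [addSubX]
  ring

/-- Ellipticity enters here: `addSubMap` then kills no nonzero vector. This yields coprimality in
the recursion for `U / V`. -/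
lemma eval_addSubX_ne_zero [W.IsElliptic] {U V : K[X]} (h : IsCoprime U V) (x : K) :
    (fun i ↦ (addSubX W U V i).eval x) ≠ 0 := by
  rw [eval_addSubX]
  refine addSubMap_ne_zero W fun h0 ↦ ?_
  have hV : V.eval x = 0 := by simpa using congrFun h0 2
  have hU : U.eval x = 0 := by simpa [hV] using congrFun h0 1
  obtain ⟨a, b, hab⟩ := h
  simpa [hU, hV] using congrArg (eval x) hab

section degree

variable {U V : K[X]}

lemma natDegree_lt_of_degree_lt (hV : V.degree < U.degree) (hd : U.natDegree ≠ 0) :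
    V.natDegree < U.natDegree := by
  by_cases h : V = 0
  · simpa [h] using Nat.pos_of_ne_zero hd
  · exact natDegree_lt_natDegree h hV

lemma natDegree_addSubX_aux (a : K) (hd : V.natDegree < U.natDegree) :
    (C a * (U * X) * V).natDegree ≤ 2 * U.natDegree ∧
    (C a * (U + X * V) * V).natDegree ≤ 2 * U.natDegree ∧
    (C a * V ^ 2).natDegree ≤ 2 * U.natDegree ∧
    (U + X * V).natDegree ≤ U.natDegree := by
  have h₁ : (U * X).natDegree ≤ U.natDegree + 1 :=
    natDegree_mul_le.trans (by rw [natDegree_X])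
  have h₂ : (U + X * V).natDegree ≤ U.natDegree := by
    refine (natDegree_add_le _ _).trans (max_le le_rfl (natDegree_mul_le.trans ?_))
    rw [natDegree_X]; omega
  refine ⟨?_, ?_, ?_, h₂⟩
  · refine natDegree_mul_le.trans ?_
    have := (natDegree_C_mul_le a (U * X)).trans h₁
    omega
  · refine natDegree_mul_le.trans ?_
    have := (natDegree_C_mul_le a (U + X * V)).trans h₂
    omega
  · refine (natDegree_C_mul_le a _).trans (natDegree_pow_le.trans ?_)
    omega

lemma natDegree_addSubX_zero (hU : U.Monic) (hV : V.degree < U.degree) (hd : U.natDegree ≠ 0) :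
    (addSubX W U V 0).Monic ∧ (addSubX W U V 0).natDegree = 2 * U.natDegree + 2 := by
  have hlt := natDegree_lt_of_degree_lt hV hd
  have hm : ((U * X) ^ 2).Monic := (hU.mul monic_X).pow 2
  have hn : ((U * X) ^ 2).natDegree = 2 * U.natDegree + 2 := by
    rw [(hU.mul monic_X).natDegree_pow, hU.natDegree_mul monic_X, natDegree_X]
    ring
  have hr : (C W.b₄ * (U * X) * V + C W.b₆ * (U + X * V) * V + C W.b₈ * V ^ 2).natDegree <
      ((U * X) ^ 2).natDegree := by
    rw [hn, Nat.lt_succ_iff]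
    refine (natDegree_add_le_of_degree_le (natDegree_add_le_of_degree_le
      (natDegree_addSubX_aux _ hlt).1 (natDegree_addSubX_aux _ hlt).2.1)
      (natDegree_addSubX_aux _ hlt).2.2.1).trans (Nat.le_succ _)
  refine ⟨hm.sub_of_left (degree_lt_degree hr), ?_⟩
  rw [← hn]
  exact natDegree_sub_eq_left_of_natDegree_lt hr

lemma natDegree_addSubX_one (hV : V.degree < U.degree) (hd : U.natDegree ≠ 0) :
    (addSubX W U V 1).natDegree ≤ 2 * U.natDegree + 1 := by
  have hlt := natDegree_lt_of_degree_lt hV hd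
  have h : (2 * (U + X * V) * (U * X)).natDegree ≤ 2 * U.natDegree + 1 := by
    have h₁ : (2 * (U + X * V)).natDegree ≤ U.natDegree :=
      (natDegree_C_mul_le (2 : K) _).trans (natDegree_addSubX_aux 0 hlt).2.2.2
    have h₂ : (U * X).natDegree ≤ U.natDegree + 1 := natDegree_mul_le.trans (by rw [natDegree_X])
    exact natDegree_mul_le.trans (by omega)
  exact natDegree_add_le_of_degree_le (natDegree_add_le_of_degree_le
    (natDegree_add_le_of_degree_le h ((natDegree_addSubX_aux _ hlt).1.trans (Nat.le_succ _)))
      ((natDegree_addSubX_aux _ hlt).2.1.trans (Nat.le_succ _)))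
      ((natDegree_addSubX_aux _ hlt).2.2.1.trans (Nat.le_succ _))

end degree

variable [DecidableEq K]

/-- The fraction `U / V` is in lowest terms and gives the `x`-coordinate of `n • P` in terms of the
`x`-coordinate of `P`. -/
structure IsMulByX (W : Affine K) (n : ℕ) (U V : K[X]) : Prop where
  monic : U.Monic
  natDegree : U.natDegree = n ^ 2
  degree_lt : V.degree < (n ^ 2 : ℕ)
  isCoprime : IsCoprime U V
  xRep : ∀ {x y : K} (h : W.Nonsingular x y),
    ∃ c : K, ![U.eval x, V.eval x] = c • (n • Point.some x y h).xRep

lemma isMulByX_zero (W : Affine K) : IsMulByX W 0 1 0 where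
  monic := monic_one
  natDegree := by simp
  degree_lt := by simp
  isCoprime := isCoprime_one_left
  xRep h := ⟨1, by simp⟩

lemma isMulByX_one (W : Affine K) : IsMulByX W 1 X 1 where
  monic := monic_X
  natDegree := by simp
  degree_lt := by simp
  isCoprime := isCoprime_one_right
  xRep h := ⟨1, by simp⟩

/-- The addition formula for `(n + 1) • P` and `P`, whose sum and difference are `(n + 2) • P` and
`n • P`. -/
lemma IsMulByX.exists_eval_addSubX {n : ℕ} {U V : K[X]} (hUV : IsMulByX W (n + 1) U V)
    {x y : K} (h : W.Nonsingular x y) : ∃ c : K, (fun i ↦ (addSubX W U V i).eval x) =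
      c • ((n + 2) • Point.some x y h).sym2x (n • Point.some x y h) := by
  obtain ⟨c, hc⟩ := hUV.xRep h
  obtain ⟨d, hd⟩ := Point.exists_addSubMap_sym2x ((n + 1) • Point.some x y h) (Point.some x y h)
  have h₁ : (n + 1) • Point.some x y h + Point.some x y h = (n + 2) • Point.some x y h := by
    rw [← succ_nsmul]
  have h₂ : (n + 1) • Point.some x y h - Point.some x y h = n • Point.some x y h := by
    rw [succ_nsmul, add_sub_cancel_right]
  rw [h₁, h₂] at hd
  refine ⟨c ^ 2 * d, ?_⟩
  rw [mul_smul, ← hd, eval_addSubX, eval_addSubMap, eval_addSubMap]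
  have hU : U.eval x = c * ((n + 1) • Point.some x y h).xRep 0 := by simpa using congrFun hc 0
  have hV : V.eval x = c * ((n + 1) • Point.some x y h).xRep 1 := by simpa using congrFun hc 1
  ext i
  fin_cases i <;> simp [hU, hV, Point.sym2x] <;> ring

/-- The three polynomials are the coefficients of a binary quadratic form with roots `x ((n + 2) •
P)` and `x (n • P)`. The second root `U₀ / V₀` is known, and coprimality lets its linear factor be
split off over `K[X]`. -/
lemma IsMulByX.exists_factor [IsAlgClosed K] [W.IsElliptic] {n : ℕ} {U₀ V₀ U V : K[X]}
    (h₀ : IsMulByX W n U₀ V₀) (h : IsMulByX W (n + 1) U V) :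
    ∃ U' V', addSubX W U V 0 = U₀ * U' ∧ addSubX W U V 1 = V' * U₀ + U' * V₀ ∧
      addSubX W U V 2 = V₀ * V' := by
  -- Every `x` lifts to a point, so the identity can be checked pointwise.
  have key : addSubX W U V 2 * U₀ ^ 2 - addSubX W U V 1 * U₀ * V₀ + addSubX W U V 0 * V₀ ^ 2 = 0 := by
    refine Polynomial.funext fun x ↦ ?_
    obtain ⟨y, hxy⟩ := exists_point_of_x (W := W) x
    obtain ⟨c, hc⟩ := h.exists_eval_addSubX hxy
    obtain ⟨d, hd⟩ := h₀.xRep hxy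
    have hU : U₀.eval x = d * (n • Point.some x y hxy).xRep 0 := by simpa using congrFun hd 0
    have hV : V₀.eval x = d * (n • Point.some x y hxy).xRep 1 := by simpa using congrFun hd 1
    have hT := congrFun hc 0
    have hS := congrFun hc 1
    have hD := congrFun hc 2
    simp only [Pi.smul_apply, smul_eq_mul, Point.sym2x, Matrix.cons_val] at hT hS hD
    simp only [eval_add, eval_sub, eval_mul, eval_pow, hT, hS, hD, hU, hV, eval_zero]
    ring
  by_cases hV₀ : V₀ = 0
  · subst hV₀
    have hU₀ : U₀ = 1 := h₀.monic.eq_one_of_isUnit (isCoprime_zero_right.mp h₀.isCoprime)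
    subst hU₀
    exact ⟨addSubX W U V 0, addSubX W U V 1, by ring, by ring, by linear_combination key⟩
  · have hU₀ := h₀.monic.ne_zero
    obtain ⟨V', hV'⟩ : V₀ ∣ addSubX W U V 2 := by
      refine (h₀.isCoprime.symm.pow_right (n := 2)).dvd_of_dvd_mul_right
        ⟨addSubX W U V 1 * U₀ - addSubX W U V 0 * V₀, by linear_combination key⟩
    obtain ⟨U', hU'⟩ : U₀ ∣ addSubX W U V 0 := by
      refine (h₀.isCoprime.pow_right (n := 2)).dvd_of_dvd_mul_right
        ⟨addSubX W U V 1 * V₀ - addSubX W U V 2 * U₀, by linear_combination key⟩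
    refine ⟨U', V', hU', ?_, hV'⟩
    refine mul_left_cancel₀ (mul_ne_zero hU₀ hV₀) ?_
    linear_combination -key + U₀ ^ 2 * hV' + V₀ ^ 2 * hU'

theorem IsMulByX.exists_succ [IsAlgClosed K] [W.IsElliptic] {n : ℕ} {U₀ V₀ U V : K[X]}
    (h₀ : IsMulByX W n U₀ V₀) (h : IsMulByX W (n + 1) U V) :
    ∃ U' V', IsMulByX W (n + 2) U' V' := by
  obtain ⟨U', V', hT, hS, hD⟩ := h₀.exists_factor h
  have hdeg : V.degree < U.degree := by
    rw [degree_eq_natDegree h.monic.ne_zero, h.natDegree]; exact h.degree_lt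
  have hne : U.natDegree ≠ 0 := by rw [h.natDegree]; positivity
  obtain ⟨hTm, hTd⟩ := natDegree_addSubX_zero (W := W) h.monic hdeg hne
  have hSd := natDegree_addSubX_one (W := W) hdeg hne
  rw [h.natDegree] at hTd hSd
  have hU'm : U'.Monic := h₀.monic.of_mul_monic_left (hT ▸ hTm)
  -- `2 * (n + 1) ^ 2 + 2 - n ^ 2 = (n + 2) ^ 2`.
  have hU'd : U'.natDegree = (n + 2) ^ 2 := by
    rw [hT, h₀.monic.natDegree_mul hU'm, h₀.natDegree] at hTd
    linarith
  refine ⟨U', V', hU'm, hU'd, ?_, ?_, ?_⟩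
  · by_cases hV' : V' = 0
    · rw [hV', degree_zero]
      exact WithBot.bot_lt_coe _
    rw [degree_eq_natDegree hV', Nat.cast_lt]
    -- Otherwise `V' * U₀` would dominate the middle coefficient, giving it degree at least `(n + 2)
    -- ^ 2 + n ^ 2 = 2 * (n + 1) ^ 2 + 2`, one more than allowed.
    by_contra! hle
    have h₁ : (U' * V₀).degree < (V' * U₀).degree := by
      rw [degree_mul, degree_mul, degree_eq_natDegree hU'm.ne_zero, hU'd,
        degree_eq_natDegree hV', degree_eq_natDegree h₀.monic.ne_zero, h₀.natDegree]
      exact WithBot.add_lt_add_of_le_of_lt (WithBot.coe_ne_bot) (by exact_mod_cast hle) h₀.degree_lt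
    have h₂ : (addSubX W U V 1).natDegree = (V' * U₀).natDegree := by
      rw [hS]
      exact natDegree_eq_of_degree_eq (degree_add_eq_left_of_degree_lt h₁)
    rw [h₂, natDegree_mul hV' h₀.monic.ne_zero, h₀.natDegree] at hSd
    nlinarith
  -- A common root of `U'` and `V'` would be a common root of all three coefficients.
  · refine (isCoprime_iff_aeval_ne_zero_of_isAlgClosed K K U' V').mpr fun x ↦ ?_
    by_contra! hx
    simp only [coe_aeval_eq_eval] at hx
    refine eval_addSubX_ne_zero (W := W) h.isCoprime x ?_
    ext i
    fin_cases i <;> simp [hT, hS, hD, hx]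
  · intro x y hxy
    obtain ⟨c, hc⟩ := h.exists_eval_addSubX hxy
    obtain ⟨d, hd⟩ := h₀.xRep hxy
    have hd0 : d ≠ 0 := by
      rintro rfl
      obtain ⟨a, b, hab⟩ := h₀.isCoprime
      have hU : U₀.eval x = 0 := by simpa using congrFun hd 0
      have hV : V₀.eval x = 0 := by simpa using congrFun hd 1
      simpa [hU, hV] using congrArg (eval x) hab
    have hU : U₀.eval x = d * (n • Point.some x y hxy).xRep 0 := by simpa using congrFun hd 0
    have hV : V₀.eval x = d * (n • Point.some x y hxy).xRep 1 := by simpa using congrFun hd 1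
    have eT := congrFun hc 0
    have eS := congrFun hc 1
    have eD := congrFun hc 2
    simp only [Pi.smul_apply, smul_eq_mul, Point.sym2x, Matrix.cons_val, hT, hS, hD, eval_add,
      eval_mul, hU, hV] at eT eS eD
    refine ⟨c / d, ?_⟩
    generalize (n + 2) • Point.some x y hxy = P at eT eS eD ⊢
    generalize n • Point.some x y hxy = Q at eT eS eD
    rcases Q with _ | ⟨x', y', h'⟩
    · simp only [← Point.zero_def, Point.xRep_zero, Matrix.cons_val] at eT eS eD
      ext i
      fin_cases i
      · simp; field_simp; linear_combination eT
      · simp; field_simp; linear_combination eS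
    · simp only [Point.xRep_some, Matrix.cons_val] at eT eS eD
      ext i
      fin_cases i
      · simp; field_simp; linear_combination eS - x' * eD
      · simp; field_simp; linear_combination eD

theorem exists_isMulByX [IsAlgClosed K] (W : Affine K) [W.IsElliptic] (n : ℕ) :
    ∃ U V, IsMulByX W n U V := by
  suffices (∃ U V, IsMulByX W n U V) ∧ ∃ U V, IsMulByX W (n + 1) U V from this.1
  induction n with
  | zero => exact ⟨⟨_, _, isMulByX_zero W⟩, ⟨_, _, isMulByX_one W⟩⟩
  | succ n ih =>
    obtain ⟨⟨U₀, V₀, h₀⟩, U, V, h⟩ := ih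
    exact ⟨⟨U, V, h⟩, h₀.exists_succ h⟩

end WeierstrassCurve.Affine

/-! ### Counting fibres of multiplication by `n`. -/

namespace WeierstrassCurve.Affine

open Polynomial

variable {K : Type*} [Field K] {W : Affine K}

lemma IsMulByX.eval_ne_zero [DecidableEq K] {n : ℕ} {U V : K[X]} (h : IsMulByX W n U V) {x : K}
    (hV : V.eval x = 0) : U.eval x ≠ 0 := by
  intro hU
  obtain ⟨a, b, hab⟩ := h.isCoprime
  simpa [hU, hV] using congrArg (eval x) hab

/-- A double root of `U - c V` is a zero of the Wronskian. -/
lemma separable_sub_C_mul [IsAlgClosed K] {U V : K[X]} {c : K}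
    (hc : ∀ x, (wronskian U V).eval x = 0 → U.eval x ≠ c * V.eval x) :
    (U - C c * V).Separable := by
  refine (isCoprime_iff_aeval_ne_zero_of_isAlgClosed K K _ _).mpr fun x ↦ ?_
  by_contra! hx
  simp only [coe_aeval_eq_eval, derivative_sub, derivative_mul, derivative_C, eval_sub, eval_mul,
    eval_C, zero_mul, zero_add] at hx
  refine hc x ?_ (sub_eq_zero.mp hx.1)
  simp only [wronskian, eval_sub, eval_mul]
  linear_combination (derivative V).eval x * hx.1 - V.eval x * hx.2

lemma wronskian_ne_zero_of_natDegree_ne_zero [CharZero K] {U V : K[X]} (h : IsCoprime U V)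
    (hU : U.natDegree ≠ 0) : wronskian U V ≠ 0 := by
  intro h0
  have := h.wronskian_eq_zero_iff.mp h0
  exact hU (derivative_eq_zero.mp this.1)

variable [DecidableEq K] [IsAlgClosed K]

/-- Taking `x`-coordinates is a bijection from the fibre to the `n ^ 2` simple roots of `U - c V`.
An abscissa fixes a point up to sign, and since the target is not its own negative exactly one sign
lies over it. -/
lemma IsMulByX.card_fiber [W.IsElliptic] {n : ℕ} {U V : K[X]} (h : IsMulByX W n U V) {c d : K}
    (hcd : W.Nonsingular c d) (hd : d ≠ W.negY c d)
    (hc : ∀ x, (wronskian U V).eval x = 0 → U.eval x ≠ c * V.eval x) :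
    Nat.card {P : W.Point // n • P = .some c d hcd} = n ^ 2 := by
  have hlt : (C c * V).degree < U.degree := by
    refine (degree_mul_le _ _).trans_lt ?_
    rw [degree_eq_natDegree h.monic.ne_zero, h.natDegree]
    refine lt_of_le_of_lt ?_ h.degree_lt
    exact (add_le_add_left degree_C_le _).trans (zero_add _).le
  have hm : (U - C c * V).natDegree = n ^ 2 := by
    rw [← h.natDegree]
    exact natDegree_eq_of_degree_eq (degree_sub_eq_left_of_degree_lt hlt)
  have hne : U - C c * V ≠ 0 := (h.monic.sub_of_left hlt).ne_zero
  have hroot : ∀ x, x ∈ (U - C c * V).rootSet K ↔ U.eval x = c * V.eval x := fun x ↦ by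
    rw [mem_rootSet_of_ne hne]
    simp [sub_eq_zero]
  rw [← hm, ← card_rootSet_eq_natDegree (K := K) (separable_sub_C_mul hc) (IsAlgClosed.splits _),
    ← Nat.card_eq_fintype_card]
  have hself : (Point.some c d hcd) ≠ -Point.some c d hcd := by
    rw [Point.neg_some]
    exact fun h ↦ hd (Point.some.inj h).2
  refine Nat.card_congr (Equiv.ofBijective (fun P ↦ ⟨P.1.xRep 0, ?_⟩) ⟨?_, ?_⟩)
  · obtain ⟨_ | ⟨x, y, hxy⟩, hP⟩ := P
    · rw [← Point.zero_def, smul_zero] at hP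
      exact absurd hP.symm (Point.some_ne_zero _)
    · obtain ⟨k, hk⟩ := h.xRep hxy
      rw [hP] at hk
      have hU : U.eval x = k * c := by simpa using congrFun hk 0
      have hV : V.eval x = k := by simpa using congrFun hk 1
      simp only [Point.xRep_some, Matrix.cons_val_zero, hroot]
      rw [hU, hV, mul_comm]
  · rintro ⟨P, hP⟩ ⟨Q, hQ⟩ hPQ
    have hx : P.xRep 0 = Q.xRep 0 := congrArg Subtype.val hPQ
    have : P = Q ∨ P = -Q := by
      refine Point.eq_or_eq_neg_of_xRep_eq_xRep ?_
      rcases P with _ | ⟨x, y, hxy⟩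
      · rw [← Point.zero_def, smul_zero] at hP
        exact absurd hP.symm (Point.some_ne_zero _)
      rcases Q with _ | ⟨x', y', hxy'⟩
      · rw [← Point.zero_def, smul_zero] at hQ
        exact absurd hQ.symm (Point.some_ne_zero _)
      simpa using hx
    rcases this with rfl | rfl
    · rfl
    · rw [smul_neg, hQ] at hP
      exact absurd hP.symm hself
  · rintro ⟨x, hx⟩
    rw [hroot] at hx
    obtain ⟨y, hxy⟩ := exists_point_of_x (W := W) x
    obtain ⟨k, hk⟩ := h.xRep hxy
    have hU : U.eval x = k * (n • Point.some x y hxy).xRep 0 := by simpa using congrFun hk 0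
    have hV : V.eval x = k * (n • Point.some x y hxy).xRep 1 := by simpa using congrFun hk 1
    have hV0 : V.eval x ≠ 0 := fun h0 ↦ h.eval_ne_zero h0 (by rw [hx, h0, mul_zero])
    have : n • Point.some x y hxy = .some c d hcd ∨ n • Point.some x y hxy = -.some c d hcd := by
      refine Point.eq_or_eq_neg_of_xRep_eq_xRep ?_
      generalize n • Point.some x y hxy = Q at hU hV
      rcases Q with _ | ⟨x', y', hxy'⟩
      · simp [← Point.zero_def] at hV
        exact absurd hV hV0
      · simp only [Point.xRep_some, Matrix.cons_val] at hU hV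
        rw [hx, hV, mul_one, mul_comm] at hU
        have : k ≠ 0 := by rintro rfl; simp [hV] at hV0
        simp [mul_left_cancel₀ this hU]
    rcases this with h' | h'
    · exact ⟨⟨_, h'⟩, by simp⟩
    · exact ⟨⟨-Point.some x y hxy, by rw [smul_neg, h', neg_neg]⟩, by simp⟩

/-- Over an algebraically closed field of characteristic zero, an elliptic curve has `n ^ 2` points
killed by `n`. -/
theorem card_nsmul_eq_zero [CharZero K] (W : Affine K) [W.IsElliptic] {n : ℕ} (hn : n ≠ 0) :
    Nat.card {P : W.Point // n • P = 0} = n ^ 2 := by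
  obtain ⟨U, V, h⟩ := exists_isMulByX W n
  have hw : wronskian U V ≠ 0 := wronskian_ne_zero_of_natDegree_ne_zero h.isCoprime (by
    rw [h.natDegree]; positivity)
  -- Avoid the finitely many critical values of `U / V` and abscissas of 2-torsion points.
  obtain ⟨c, hc⟩ := Infinite.exists_notMem_finset
    ((wronskian U V).roots.toFinset.image (fun x ↦ U.eval x / V.eval x) ∪ W.Ψ₂Sq.roots.toFinset)
  rw [Finset.notMem_union] at hc
  obtain ⟨d, hcd⟩ := exists_point_of_x (W := W) c
  have hd : d ≠ W.negY c d := by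
    intro hd
    refine hc.2 (Multiset.mem_toFinset.mpr
      ((mem_roots (Ψ₂Sq_ne_zero W (by norm_num))).mpr ?_))
    rw [negY] at hd
    have e := (equation_iff _ _).mp hcd.1
    simp only [IsRoot.def, Ψ₂Sq, eval_add, eval_mul, eval_C, eval_pow, eval_X, b₂, b₄, b₆]
    linear_combination (2 * d + W.a₁ * c + W.a₃) * hd - 4 * e
  have hfib := h.card_fiber hcd hd fun x hx hUV ↦ hc.1 (Finset.mem_image.mpr
    ⟨x, Multiset.mem_toFinset.mpr ((mem_roots hw).mpr hx), by
      have : V.eval x ≠ 0 := fun h0 ↦ h.eval_ne_zero h0 (by rw [hUV, h0, mul_zero])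
      rw [hUV, mul_div_cancel_right₀ _ this]⟩)
  have : Nonempty {P : W.Point // n • P = .some c d hcd} :=
    (Nat.card_ne_zero.mp (by rw [hfib]; positivity)).1
  obtain ⟨P₀, hP₀⟩ := this
  rw [← hfib]
  -- Translation by `P₀` carries the kernel onto the fibre.
  exact Nat.card_congr ((Equiv.addRight P₀).subtypeEquiv fun P ↦ by
    rw [Equiv.coe_addRight, smul_add, hP₀, add_eq_right])

end WeierstrassCurve.Affine

/-! ### Abelian groups with `n ^ 2` elements killed by each `n ≠ 0`. -/

namespace AddCommGroup

variable {A : Type*} [AddCommGroup A]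

/-- The elements `P` and `Q` satisfy no linear relation that is non-trivial modulo `n`. -/
def IndepMod (n : ℕ) (P Q : A) : Prop :=
  ∀ a b : ℤ, a • P + b • Q = 0 → (n : ℤ) ∣ a ∧ (n : ℤ) ∣ b

/-- Multiplying a relation by a power of `p` shows its coefficients divisible by `p`; dividing them
by `p` gives a relation between `p • P` and `p • Q`, so induction applies. -/
lemma IndepMod.of_pow_nsmul {p k : ℕ} {P Q : A}
    (h : IndepMod p (p ^ k • P) (p ^ k • Q)) : IndepMod (p ^ (k + 1)) P Q := by
  induction k generalizing P Q with
  | zero => simpa using h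
  | succ k ih =>
    intro a b hab
    obtain ⟨⟨a, rfl⟩, ⟨b, rfl⟩⟩ := h a b (by
      rw [smul_comm a, smul_comm b, ← smul_add, hab, smul_zero])
    obtain ⟨ha, hb⟩ := ih (P := p • P) (Q := p • Q) (by simpa only [smul_smul, ← pow_succ] using h)
      a b (by rw [← hab, mul_comm, mul_smul, mul_comm, mul_smul, natCast_zsmul, natCast_zsmul])
    rw [pow_succ', Nat.cast_mul]
    exact ⟨mul_dvd_mul_left _ ha, mul_dvd_mul_left _ hb⟩

variable (hA : ∀ n : ℕ, n ≠ 0 → Nat.card {P : A // n • P = 0} = n ^ 2)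

include hA

/-- Multiplication by `a` maps `A[ab]` to `A[b]` with kernel `A[a]`, so its image has `(ab) ^ 2 / a
^ 2 = b ^ 2` elements, which is all of `A[b]`. -/
lemma exists_nsmul_eq_of_card {a b : ℕ} (ha : a ≠ 0) (hb : b ≠ 0) {R : A} (hR : b • R = 0) :
    ∃ Q, a • Q = R := by
  let T (n : ℕ) : AddSubgroup A := (nsmulAddMonoidHom n).ker
  have hT (n : ℕ) (hn : n ≠ 0) : Nat.card (T n) = n ^ 2 := hA n hn
  let f : T (a * b) →+ T b := ((nsmulAddMonoidHom a).comp (T (a * b)).subtype).codRestrict (T b)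
    fun x ↦ by
      have := x.2
      simp only [T, AddMonoidHom.mem_ker, nsmulAddMonoidHom_apply] at this
      simp [T, smul_smul, mul_comm b, this]
  have hker : Nat.card f.ker = a ^ 2 := by
    rw [← hT a ha]
    refine Nat.card_congr ⟨fun x ↦ ⟨x.1.1, ?_⟩, fun x ↦ ⟨⟨x.1, ?_⟩, ?_⟩, fun _ ↦ rfl, fun _ ↦ rfl⟩
    · have := congrArg Subtype.val x.2
      simpa [f, T] using this
    · have : a • x.1 = 0 := x.2
      simp [T, mul_comm a, mul_smul, this]
    · exact Subtype.ext x.2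
  have hrange : Nat.card f.range = Nat.card (T b) := by
    have := f.ker.card_mul_index
    rw [AddSubgroup.index_ker, hker, hT _ (mul_ne_zero ha hb), mul_pow] at this
    rw [hT b hb]
    exact Nat.eq_of_mul_eq_mul_left (by positivity) this
  have : Finite (T b) := Nat.finite_of_card_ne_zero (by rw [hT b hb]; positivity)
  have htop : f.range = ⊤ := AddSubgroup.eq_top_of_card_eq _ hrange
  obtain ⟨Q, hQ⟩ := AddMonoidHom.range_eq_top.mp htop ⟨R, hR⟩
  exact ⟨Q, congrArg Subtype.val hQ⟩

variable {p : ℕ} (hp : p.Prime)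

include hp

lemma exists_indepMod_prime {Q : A} (hQ : addOrderOf Q = p) :
    ∃ P : A, p • P = 0 ∧ IndepMod p P Q := by
  have hlt : Nat.card (AddSubgroup.zmultiples Q) < Nat.card {P : A // p • P = 0} := by
    rw [hA p hp.ne_zero, Nat.card_zmultiples, hQ]
    nlinarith [hp.two_le]
  obtain ⟨P, hP, hPQ⟩ : ∃ P : A, p • P = 0 ∧ P ∉ AddSubgroup.zmultiples Q := by
    by_contra! hall
    have : Finite (AddSubgroup.zmultiples Q) :=
      Nat.finite_of_card_ne_zero (by rw [Nat.card_zmultiples, hQ]; exact hp.ne_zero)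
    exact hlt.not_ge (Nat.card_le_card_of_injective
      (fun P : {P : A // p • P = 0} ↦ (⟨P.1, hall P.1 P.2⟩ : AddSubgroup.zmultiples Q))
      fun P P' h ↦ Subtype.ext (Subtype.mk.inj h))
  refine ⟨P, hP, fun a b hab ↦ ?_⟩
  have ha : (p : ℤ) ∣ a := by
    by_contra ha
    obtain ⟨u, v, huv⟩ := ((Nat.prime_iff_prime_int.mp hp).coprime_iff_not_dvd.mpr ha)
    refine hPQ (AddSubgroup.mem_zmultiples_iff.mpr ⟨-(v * b), ?_⟩)
    have h₁ : P = (u * p + v * a) • P := by rw [huv, one_smul]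
    rw [add_smul, mul_smul, natCast_zsmul, hP, smul_zero, zero_add, mul_smul,
      eq_neg_of_add_eq_zero_left hab] at h₁
    rw [h₁, neg_smul, mul_smul, smul_neg]
  refine ⟨ha, ?_⟩
  obtain ⟨c, rfl⟩ := ha
  rw [mul_comm, mul_smul, natCast_zsmul, hP, smul_zero, zero_add] at hab
  rw [← hQ]
  exact addOrderOf_dvd_iff_zsmul_eq_zero.mpr hab

/-- An element of order `p ^ k` is part of a basis of the `p ^ k`-torsion. -/
lemma exists_indepMod_prime_pow {k : ℕ} {Q : A} (hQ : addOrderOf Q = p ^ k) :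
    ∃ P : A, p ^ k • P = 0 ∧ IndepMod (p ^ k) P Q := by
  cases k with
  | zero => exact ⟨0, by simp, fun a b _ ↦ by simp⟩
  | succ k =>
    have hQ' : addOrderOf (p ^ k • Q) = p := by
      rw [addOrderOf_nsmul_of_dvd (pow_ne_zero _ hp.ne_zero) (hQ ▸ pow_dvd_pow p k.le_succ), hQ,
        pow_succ, Nat.mul_div_cancel_left _ (pow_pos hp.pos k)]
    obtain ⟨P₀, hP₀, hind⟩ := exists_indepMod_prime hA hp hQ'
    -- Dividing the partner of `p ^ k • Q` in the `p`-torsion by `p ^ k` gives a partner of `Q`.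
    obtain ⟨P, rfl⟩ := exists_nsmul_eq_of_card hA (pow_ne_zero k hp.ne_zero) hp.ne_zero hP₀
    exact ⟨P, by rw [pow_succ', mul_smul, hP₀], hind.of_pow_nsmul⟩

/-- For `g ≠ 0` any `Q` with `p ^ m • Q = g` has the right order. For `g = 0` such a `Q` may have
smaller order, so an element `Z` of order `p` is divided instead, by one power of `p` fewer. -/
lemma exists_addOrderOf_eq_prime_pow_of_card {r : ℕ} (m : ℕ) {g : A} (hg : addOrderOf g = p ^ r) :
    ∃ Q : A, addOrderOf Q = p ^ (m + r) ∧ p ^ m • Q = g := by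
  have := Fact.mk hp
  have key : ∀ (r m : ℕ) (g : A), addOrderOf g = p ^ (r + 1) →
      ∃ Q : A, addOrderOf Q = p ^ (m + (r + 1)) ∧ p ^ m • Q = g := by
    intro r m g hg
    have hg0 : p ^ (r + 1) • g = 0 := hg ▸ addOrderOf_nsmul_eq_zero g
    obtain ⟨Q, rfl⟩ := exists_nsmul_eq_of_card hA (pow_ne_zero m hp.ne_zero)
      (pow_ne_zero _ hp.ne_zero) hg0
    rw [← add_assoc]
    refine ⟨Q, addOrderOf_eq_prime_pow (fun h ↦ ?_) ?_, rfl⟩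
    · rw [pow_add, mul_comm, mul_smul, ← addOrderOf_dvd_iff_nsmul_eq_zero, hg] at h
      exact absurd ((Nat.pow_dvd_pow_iff_le_right hp.one_lt).mp h) (by omega)
    · rw [← hg0, smul_smul, ← pow_add]
      congr 2
      ring
  cases r with
  | succ r => exact key r m g hg
  | zero =>
    obtain rfl : g = 0 := by simpa using hg
    cases m with
    | zero => exact ⟨0, by simp⟩
    | succ m =>
      have : Nontrivial {P : A // p • P = 0} := by
        have hc := hA p hp.ne_zero
        have := Nat.finite_of_card_ne_zero (hc ▸ pow_ne_zero 2 hp.ne_zero)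
        exact Finite.one_lt_card_iff_nontrivial.mp (hc ▸ Nat.one_lt_pow two_ne_zero hp.one_lt)
      obtain ⟨⟨Z, hZ⟩, hZ0⟩ := exists_ne (⟨0, smul_zero p⟩ : {P : A // p • P = 0})
      have hZp : addOrderOf Z = p := addOrderOf_eq_prime hZ fun h ↦ hZ0 (Subtype.ext h)
      obtain ⟨Q, hQ, hQZ⟩ := key 0 m Z (by simpa using hZp)
      exact ⟨Q, by simpa using hQ, by rw [pow_succ', mul_smul, hQZ, hZ]⟩

end AddCommGroup

namespace AddCommGroup

/-- Independence is injectivity of the map from `(ZMod n) ^ 2`; equal finite cardinalities make it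
bijective. -/
lemma exists_basis_of_indepMod {A : Type*} [AddCommGroup A] {n : ℕ} [NeZero n] [Module (ZMod n) A]
    (hA : Nat.card A = n ^ 2) {P Q : A} (h : IndepMod n P Q) :
    ∃ b : Module.Basis (Fin 2) (ZMod n) A, b 0 = P ∧ b 1 = Q := by
  have hinj : Function.Injective (Fintype.linearCombination (ZMod n) ![P, Q]) := by
    rw [injective_iff_map_eq_zero]
    intro c hc
    rw [Fintype.linearCombination_apply, Fin.sum_univ_two] at hc
    obtain ⟨a, ha⟩ := ZMod.intCast_surjective (c 0)
    obtain ⟨b, hb⟩ := ZMod.intCast_surjective (c 1)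
    rw [← ha, ← hb, Int.cast_smul_eq_zsmul, Int.cast_smul_eq_zsmul] at hc
    obtain ⟨h₁, h₂⟩ := h a b hc
    ext i
    fin_cases i
    · simpa [← ha] using (ZMod.intCast_zmod_eq_zero_iff_dvd a n).mpr h₁
    · simpa [← hb] using (ZMod.intCast_zmod_eq_zero_iff_dvd b n).mpr h₂
  have : Finite A := Nat.finite_of_card_ne_zero (hA ▸ pow_ne_zero 2 (NeZero.ne n))
  have hbij := (Nat.bijective_iff_injective_and_card _).mpr
    ⟨hinj, by rw [hA, Nat.card_fun, Nat.card_zmod, Nat.card_fin]⟩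
  refine ⟨.ofEquivFun (LinearEquiv.ofBijective _ hbij).symm, ?_, ?_⟩ <;>
    simp [Fintype.linearCombination_apply]

end AddCommGroup

/-! ### Galois action, morphisms over `ℚ` and matrices. -/

namespace EllQ

open AddCommGroup

variable {E E' : WeierstrassCurve ℚ}

/-- An element of the absolute Galois group as an automorphism of `ℚ̄`. -/
abbrev toAut (σ : Field.absoluteGaloisGroup ℚ) : Qbar ≃ₐ[ℚ] Qbar := σ

lemma coords_galAct (σ : Field.absoluteGaloisGroup ℚ) (P : Pts E) (i : Fin 3) :
    coords (galAct E σ P) i = toAut σ (coords P i) := by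
  rcases P with _ | ⟨x, y, h⟩
  · change coords (.zero : Pts E) i = _
    fin_cases i <;> simp [coords]
  · change ![toAut σ x, toAut σ y, 1] i = toAut σ (![x, y, 1] i)
    fin_cases i <;> simp

lemma eq_of_coords_eq_mul {P Q : Pts E} {c : Qbar} (h : ∀ i, coords P i = c * coords Q i) :
    P = Q := by
  have h0 := h 0
  have h1 := h 1
  have h2 := h 2
  rcases P with _ | ⟨x, y, hxy⟩ <;> rcases Q with _ | ⟨x', y', hxy'⟩ <;>
    simp [coords] at h0 h1 h2
  · rfl
  · simp [← h2] at h1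
  · subst h2
    simp at h0 h1
    subst h0 h1
    rfl

lemma aeval_coords_galAct (σ : Field.absoluteGaloisGroup ℚ) (P : Pts E)
    (F : MvPolynomial (Fin 3) ℚ) :
    MvPolynomial.aeval (coords (galAct E σ P)) F = toAut σ (MvPolynomial.aeval (coords P) F) := by
  have h : coords (galAct E σ P) = fun i ↦ toAut σ (coords P i) := funext (coords_galAct σ P)
  rw [h, ← AlgEquiv.coe_toAlgHom (toAut σ)]
  exact (MvPolynomial.comp_aeval_apply _ _ _).symm

/-- A morphism defined over `ℚ` commutes with the action of the Galois group. -/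
lemma IsMorphism.map_galAct {f : Pts E → Pts E'} (hf : IsMorphism f)
    (σ : Field.absoluteGaloisGroup ℚ) (P : Pts E) : f (galAct E σ P) = galAct E' σ (f P) := by
  obtain ⟨d, F, -, ⟨i, hi⟩, hF⟩ := hf P
  obtain ⟨c, hc⟩ := hF P
  -- The polynomials chosen around `P` also serve at `σ P`: their coefficients are rational, so
  -- their values there are the conjugates of those at `P` and do not all vanish.
  obtain ⟨c', hc'⟩ := hF (galAct E σ P)
  have hc0 : c' ≠ 0 := by
    rintro rfl
    have := hc' i
    rw [aeval_coords_galAct, zero_mul] at this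
    exact hi (by simpa using this)
  refine eq_of_coords_eq_mul (c := toAut σ c / c') fun j ↦ ?_
  have := hc' j
  rw [aeval_coords_galAct, hc, map_mul] at this
  rw [coords_galAct, div_mul_eq_mul_div, this, mul_div_cancel_left₀ _ hc0]

instance (E : WeierstrassCurve ℚ) [E.IsElliptic] : (E.toAffine⁄Qbar).IsElliptic :=
  inferInstanceAs (E.map (algebraMap ℚ Qbar)).IsElliptic

lemma card_pts_nsmul_eq_zero (E : WeierstrassCurve ℚ) [E.IsElliptic] (n : ℕ) (hn : n ≠ 0) :
    Nat.card {P : Pts E // n • P = 0} = n ^ 2 :=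
  WeierstrassCurve.Affine.card_nsmul_eq_zero _ hn

lemma card_tors (E : WeierstrassCurve ℚ) [E.IsElliptic] {n : ℕ} (hn : n ≠ 0) :
    Nat.card (Tors E n) = n ^ 2 := by
  rw [← card_pts_nsmul_eq_zero E n hn]
  exact Nat.card_congr (Equiv.subtypeEquivRight fun P ↦ AddSubgroup.torsionBy.nsmul_iff)

lemma exists_basis_tors [E.IsElliptic] {n : ℕ} [NeZero n] {P Q : Pts E} (hP : n • P = 0)
    (hQ : n • Q = 0) (h : IndepMod n P Q) :
    ∃ b : Module.Basis (Fin 2) (ZMod n) (Tors E n), (b 0 : Pts E) = P ∧ (b 1 : Pts E) = Q := by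
  obtain ⟨b, h0, h1⟩ := exists_basis_of_indepMod (card_tors E (NeZero.ne n))
    (P := ⟨P, AddSubgroup.torsionBy.nsmul_iff.mpr hP⟩)
    (Q := ⟨Q, AddSubgroup.torsionBy.nsmul_iff.mpr hQ⟩)
    fun a b hab ↦ h a b (congrArg Subtype.val hab)
  exact ⟨b, by rw [h0], by rw [h1]⟩

/-- The matrix of a Galois automorphism on the `n`-torsion describes its action on a basis. -/
lemma toMatrix_galRep_eq_iff {n : ℕ} (b : Module.Basis (Fin 2) (ZMod n) (Tors E n))
    (σ : Field.absoluteGaloisGroup ℚ) (A B C D : ℤ) :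
    LinearMap.toMatrix b b (galRep E n σ) = !![(A : ZMod n), (C : ZMod n); (B : ZMod n), (D : ZMod n)] ↔
      galAct E σ (b 0) = A • (b 0 : Pts E) + B • (b 1 : Pts E) ∧
      galAct E σ (b 1) = C • (b 0 : Pts E) + D • (b 1 : Pts E) := by
  have key (x y : ℤ) (i : Fin 2) : galAct E σ (b i) = x • (b 0 : Pts E) + y • (b 1 : Pts E) ↔
      b.repr (galRep E n σ (b i)) 0 = (x : ZMod n) ∧ b.repr (galRep E n σ (b i)) 1 = (y : ZMod n) := by
    have h₁ : galAct E σ (b i) = x • (b 0 : Pts E) + y • (b 1 : Pts E) ↔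
        galRep E n σ (b i) = (x : ZMod n) • b 0 + (y : ZMod n) • b 1 := by
      rw [Int.cast_smul_eq_zsmul, Int.cast_smul_eq_zsmul, Subtype.ext_iff]
      rfl
    rw [h₁, ← b.repr.injective.eq_iff]
    constructor
    · intro h
      simp [h]
    · rintro ⟨h₁, h₂⟩
      ext j
      fin_cases j
      · simpa using h₁
      · simpa using h₂
  rw [key, key, ← Matrix.ext_iff]
  simp only [Fin.forall_fin_two, LinearMap.toMatrix_apply]
  simp
  tauto

end EllQ

/-! ### The primary part of the kernel and the main theorem. -/

namespace AddCommGroup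

lemma nsmul_zsmul_comm {A : Type*} [AddCommGroup A] (n : ℕ) (a : ℤ) (x : A) :
    n • a • x = a • n • x :=
  smul_comm n a x

/-- The `p`-primary part of a finite cyclic subgroup is generated by an element of order `p ^ r`. -/
lemma exists_generator_primary {A : Type*} [AddCommGroup A] (H : AddSubgroup A) [Finite H]
    [IsAddCyclic H] {p : ℕ} (hp : p.Prime) {r : ℕ}
    (hr : p ^ r ∣ Nat.card H ∧ ¬ p ^ (r + 1) ∣ Nat.card H) :
    ∃ g ∈ H, addOrderOf g = p ^ r ∧
      ∀ x ∈ H, ∀ k : ℕ, p ^ k • x = 0 → x ∈ AddSubgroup.zmultiples g := by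
  obtain ⟨⟨t, ht⟩, hr'⟩ := hr
  have hpt : ¬ p ∣ t := fun h ↦ hr' (by rw [ht, pow_succ]; exact mul_dvd_mul_left _ h)
  have ht0 : t ≠ 0 := fun h ↦ hpt (h ▸ dvd_zero p)
  obtain ⟨⟨g, hg⟩, hgen⟩ := IsAddCyclic.exists_generator (α := H)
  have hord : addOrderOf g = p ^ r * t := by
    rw [← ht, ← addOrderOf_eq_card_of_forall_mem_zmultiples hgen, AddSubgroup.addOrderOf_mk]
  -- `t` is the prime-to-`p` part of the order. If `p ^ k` kills `j • g`, then `t ∣ p ^ k * j`,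
  -- hence `t ∣ j`.
  refine ⟨t • g, nsmul_mem hg t, ?_, fun x hx k hk ↦ ?_⟩
  · rw [addOrderOf_nsmul_of_dvd ht0 (hord ▸ dvd_mul_left _ _), hord,
      Nat.mul_div_cancel _ (Nat.pos_of_ne_zero ht0)]
  · obtain ⟨j, hj⟩ := AddSubgroup.mem_zmultiples_iff.mp (hgen ⟨x, hx⟩)
    obtain rfl : j • g = x := congrArg Subtype.val hj
    rw [← natCast_zsmul, smul_smul, ← addOrderOf_dvd_iff_zsmul_eq_zero, hord] at hk
    have hcop : IsCoprime (t : ℤ) ((p ^ k : ℕ) : ℤ) :=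
      Nat.isCoprime_iff_coprime.mpr (((hp.coprime_iff_not_dvd.mpr hpt).symm).pow_right k)
    obtain ⟨i, rfl⟩ : (t : ℤ) ∣ j :=
      hcop.dvd_of_dvd_mul_left (dvd_trans (by simp) hk)
    exact AddSubgroup.mem_zmultiples_iff.mpr ⟨i, by rw [mul_comm, mul_smul, natCast_zsmul]⟩

end AddCommGroup

open AddCommGroup in
theorem mainTheorem4 (E E' : WeierstrassCurve ℚ) [E.IsElliptic] [E'.IsElliptic]
    (φ : EllQ.Isogeny E E') (hfin : Finite φ.hom.ker) (hcyc : IsAddCyclic φ.hom.ker)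
    (hrat : EllQ.IsRational φ.hom.ker)
    (ℓ : ℕ) (hℓ : ℓ.Prime) (r : ℕ)
    (hr : ℓ ^ r ∣ Nat.card φ.hom.ker ∧ ¬ ℓ ^ (r + 1) ∣ Nat.card φ.hom.ker) (m : ℕ) :
    ∃ (b : Module.Basis (Fin 2) (ZMod (ℓ ^ (m + r))) (EllQ.Tors E (ℓ ^ (m + r))))
      (b' : Module.Basis (Fin 2) (ZMod (ℓ ^ m)) (EllQ.Tors E' (ℓ ^ m))),
      (b' 0 : EllQ.Pts E') = φ.hom (ℓ ^ r • (b 0 : EllQ.Pts E)) ∧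
      (b' 1 : EllQ.Pts E') = φ.hom (b 1 : EllQ.Pts E) ∧
      ∀ (σ : Field.absoluteGaloisGroup ℚ) (A B C D : ℤ),
        LinearMap.toMatrix b b (EllQ.galRep E (ℓ ^ (m + r)) σ) =
          !![(A : ZMod (ℓ ^ (m + r))), (C : ZMod (ℓ ^ (m + r)));
             (B : ZMod (ℓ ^ (m + r))), (D : ZMod (ℓ ^ (m + r)))] →
        (ℓ : ℤ) ^ r ∣ C ∧
        LinearMap.toMatrix b' b' (EllQ.galRep E' (ℓ ^ m) σ) =
          !![(A : ZMod (ℓ ^ m)), ((C / (ℓ : ℤ) ^ r : ℤ) : ZMod (ℓ ^ m));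
             (((ℓ : ℤ) ^ r * B : ℤ) : ZMod (ℓ ^ m)), (D : ZMod (ℓ ^ m))] := by
  have hE := EllQ.card_pts_nsmul_eq_zero E
  have : NeZero ℓ := ⟨hℓ.ne_zero⟩
  have hℓ0 : (ℓ : ℤ) ≠ 0 := by exact_mod_cast hℓ.ne_zero
  obtain ⟨g, hgker, hg, hker⟩ := exists_generator_primary φ.hom.ker hℓ hr
  obtain ⟨Q, hQ, hQg⟩ := exists_addOrderOf_eq_prime_pow_of_card hE hℓ m hg
  obtain ⟨P, hP, hPQ⟩ := exists_indepMod_prime_pow hE hℓ hQ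
  have hQ0 : ℓ ^ (m + r) • Q = 0 := hQ ▸ addOrderOf_nsmul_eq_zero Q
  -- Within the `ℓ ^ (m + r)`-torsion the kernel consists of multiples of `g = ℓ ^ m • Q`.
  have hkerQ (x : EllQ.Pts E) (hx : φ.hom x = 0) (hx' : ℓ ^ (m + r) • x = 0) :
      ∃ j : ℤ, x = (j * ℓ ^ m) • Q := by
    obtain ⟨j, rfl⟩ := AddSubgroup.mem_zmultiples_iff.mp (hker x hx _ hx')
    exact ⟨j, by rw [← hQg, mul_smul, ← Nat.cast_pow, natCast_zsmul]⟩
  have hdvd {a : ℤ} {i j : ℕ} (h : ((ℓ ^ (i + j) : ℕ) : ℤ) ∣ ℓ ^ i * a) : (ℓ : ℤ) ^ j ∣ a := by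
    rw [Nat.cast_pow, pow_add] at h
    exact (mul_dvd_mul_iff_left (pow_ne_zero i hℓ0)).mp h
  -- A relation between the images puts `a • ℓ ^ r • P + b • Q` in the kernel, so it equals `(j * ℓ
  -- ^ m) • Q`. Comparing coefficients, `ℓ ^ (m + r)` divides `ℓ ^ r * a` and `b - j * ℓ ^ m`.
  have hind : IndepMod (ℓ ^ m) (φ.hom (ℓ ^ r • P)) (φ.hom Q) := by
    intro a b hab
    obtain ⟨j, hj⟩ := hkerQ (a • ℓ ^ r • P + b • Q)
      (by rw [map_add, map_zsmul, map_zsmul, hab])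
      (by rw [nsmul_add, nsmul_zsmul_comm, smul_comm _ (ℓ ^ r), hP, nsmul_zsmul_comm, hQ0, nsmul_zero,
        zsmul_zero, zsmul_zero, add_zero])
    obtain ⟨h₁, h₂⟩ := hPQ (ℓ ^ r * a) (b - j * ℓ ^ m) (by
      rw [sub_smul, ← hj, mul_comm, mul_smul, ← Nat.cast_pow, natCast_zsmul]
      abel)
    rw [add_comm] at h₁
    rw [Nat.cast_pow] at h₂ ⊢
    refine ⟨hdvd h₁, ?_⟩
    rw [← sub_add_cancel b (j * ℓ ^ m)]
    exact dvd_add ((pow_dvd_pow _ (Nat.le_add_right m r)).trans h₂) (dvd_mul_left _ _)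
  obtain ⟨b, rfl, rfl⟩ := EllQ.exists_basis_tors hP hQ0 hPQ
  obtain ⟨b', hb0, hb1⟩ := EllQ.exists_basis_tors
    (by rw [← map_nsmul, smul_smul, ← pow_add, hP, map_zero])
    (by rw [← map_nsmul, hQg]; exact hgker) hind
  refine ⟨b, b', hb0, hb1, fun σ A B C D hσ ↦ ?_⟩
  obtain ⟨hσP, hσQ⟩ := (EllQ.toMatrix_galRep_eq_iff b σ A B C D).mp hσ
  -- `σ g` lies in the kernel, hence is a multiple of `ℓ ^ m • Q`, whereas its `P`-coefficient is `ℓ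
  -- ^ m * C`.
  have hC : (ℓ : ℤ) ^ r ∣ C := by
    have hmem : EllQ.galAct E σ g ∈ φ.hom.ker := by
      have : EllQ.galAct E σ g ∈ φ.hom.ker.map (EllQ.galAct E σ) :=
        AddSubgroup.mem_map_of_mem _ hgker
      rwa [hrat σ] at this
    obtain ⟨j, hj⟩ := hkerQ _ hmem (by
      rw [← map_nsmul, ← hQg, smul_comm, hQ0, nsmul_zero, map_zero])
    rw [← hQg, map_nsmul, hσQ] at hj
    refine hdvd (hPQ (ℓ ^ m * C) (ℓ ^ m * D - j * ℓ ^ m) ?_).1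
    rw [sub_smul, ← hj, mul_smul, mul_smul, ← Nat.cast_pow, natCast_zsmul, natCast_zsmul, nsmul_add]
    abel
  refine ⟨hC, (EllQ.toMatrix_galRep_eq_iff b' σ _ _ _ _).mpr ⟨?_, ?_⟩⟩
  · rw [hb0, hb1, ← φ.isMorphism.map_galAct, map_nsmul (EllQ.galAct E σ), hσP, ← map_zsmul,
      ← map_zsmul, ← map_add, mul_smul, ← Nat.cast_pow, natCast_zsmul, nsmul_add,
      nsmul_zsmul_comm]
  · obtain ⟨c, rfl⟩ := hC
    rw [Int.mul_ediv_cancel_left _ (pow_ne_zero r hℓ0), hb0, hb1, ← φ.isMorphism.map_galAct, hσQ,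
      ← map_zsmul, ← map_zsmul, ← map_add, mul_comm, mul_smul, ← Nat.cast_pow, natCast_zsmul]
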